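/- A ReLU network $\Phi:\mathbb{R}\to\mathbb{R}$ of depth $L\in\mathbb{N}_0$ is a map $\Phi=A_L\circ\sigma\circ A_{L-1}\circ\cdots\circ\sigma\circ A_0$, where $\sigma(t)=\max\{t,0\}$ acts componentwise and $A_j:\mathbb{R}^{n_j}\to\mathbb{R}^{n_{j+1}}$, $A_j(x)=W_jx+b_j$, are affine maps with $n_0=n_{L+1}=1$; its size is the total number of nonzero entries of all weight matrices $W_j$ and bias vectors $b_j$. Let $\gamma_1$ be the standard Gaussian measure on $\mathbb{R}$, let $$H_n(x)=\frac{(-1)^n}{\sqrt{n!}}\,e^{x^2/2}\frac{d^n}{dx^n}e^{-x^2/2}$$ be the $n$-th probabilists' Hermite polynomial normalized in $L^2(\mathbb{R},\gamma_1)$, and let $k!!$ be the double factorial ($0!!=1!!=1$, $k!!=k\cdot(k-2)!!$ for $k\ge2$). **Proposition 3.3.** There is a constant $C>0$ such that for all $n\in\mathbb{N}_0$, $M\ge 2$ and $\varepsilon\in(0,e^{-1})$ there exists a ReLU network $\tilde H_{n,M,\varepsilon}:\mathbb{R}\to\mathbb{R}$ with the following properties: 1. $\|H_n-\tilde H_{n,M,\varepsilon}\|_{L^2(\mathbb{R},\gamma_1)}\le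 \varepsilon+\sqrt{(2n)!!}\,(3M)^n e^{-M^2/4}$; 2. $\tilde H_{n,M,\varepsilon}(x)=0$ for $|x|>M$, and $\sup_{x\in\mathbb{R}}|\tilde H_{n,M,\varepsilon}(x)|\le 1+(3M)^n$; 3. $\mathrm{size}(\tilde H_{n,M,\varepsilon})\le C\big(1+n^2\log M+n\log\frac{n}{\varepsilon}\big)$ and $\mathrm{depth}(\tilde H_{n,M,\varepsilon})\le C(1+\log n)(n\log M-\log\varepsilon)$, where for $n=0$ the terms $n\log\frac n\varepsilon$ and $\log n$ are read as $0$. -/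

import Mathlib

/-- Feedforward neural network architectures with weights, without skip connections, with input
dimension `n` and output dimension `m`: a finite chain of affine maps `x ↦ W x + b` (arbitrary
hidden widths), between two consecutive ones of which an activation function is applied. -/
inductive FeedforwardNN : ℕ → ℕ → Type
  /-- the last affine map -/
  | output {n m : ℕ} (W : Matrix (Fin m) (Fin n) ℝ) (b : Fin m → ℝ) : FeedforwardNN n m
  /-- an affine map, then the activation, then the rest of the network -/
  | hidden {n k m : ℕ} (W : Matrix (Fin k) (Fin n) ℝ) (b : Fin k → ℝ)
      (rest : FeedforwardNN k m) : FeedforwardNN n m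

namespace FeedforwardNN

/-- The map `A_L ∘ σ ∘ ⋯ ∘ σ ∘ A_0`, with `σ` applied componentwise. -/
noncomputable def realize (σ : ℝ → ℝ) :
    {n m : ℕ} → FeedforwardNN n m → (Fin n → ℝ) → (Fin m → ℝ)
  | _, _, output W b, x => W.mulVec x + b
  | _, _, hidden W b rest, x => realize σ rest (fun i => σ ((W.mulVec x + b) i))

/-- The number of applications of the activation function. -/
def depth : {n m : ℕ} → FeedforwardNN n m → ℕ
  | _, _, output _ _ => 0
  | _, _, hidden _ _ rest => rest.depth + 1

/-- The number of nonzero entries of a weight matrix and a bias vector. -/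
noncomputable def layerSize {n m : ℕ} (W : Matrix (Fin m) (Fin n) ℝ) (b : Fin m → ℝ) : ℕ :=
  (Finset.univ.filter fun p : Fin m × Fin n => W p.1 p.2 ≠ 0).card +
    (Finset.univ.filter fun k : Fin m => b k ≠ 0).card

/-- The total number of nonzero weights and biases. -/
noncomputable def size : {n m : ℕ} → FeedforwardNN n m → ℕ
  | _, _, output W b => layerSize W b
  | _, _, hidden W b rest => layerSize W b + rest.size

/-- The function `ℝ → ℝ` realized with the ReLU activation `t ↦ max t 0` by a network with
one-dimensional input and output. -/
noncomputable def reluFun (Φ : FeedforwardNN 1 1) (x : ℝ) : ℝ :=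
  Φ.realize (fun t => max t 0) (fun _ => x) 0

end FeedforwardNN

/-- The `n`-th probabilists' Hermite polynomial, normalized in `L²(ℝ, γ₁)`. -/
noncomputable def normHermite (n : ℕ) (x : ℝ) : ℝ :=
  Polynomial.aeval x (Polynomial.hermite n) / Real.sqrt (n.factorial : ℝ)

/-- Rodrigues' formula for the normalized Hermite polynomials. -/
theorem normHermite_eq (n : ℕ) (x : ℝ) :
    normHermite n x = (-1) ^ n / Real.sqrt (n.factorial : ℝ) * Real.exp (x ^ 2 / 2) *
      iteratedDeriv n (fun y : ℝ => Real.exp (-(y ^ 2 / 2))) x := by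
  rw [normHermite, Polynomial.hermite_eq_deriv_gaussian', iteratedDeriv_eq_iterate]
  ring

/-! The three-term recurrence makes a Hermite polynomial a product of `2 × 2` matrices: right
multiplication by a matrix affine in `y` sends the row `(H_k, H_{k-1})` to `(H_{k+1}, H_k)`. Padded
with identities to `2 ^ J ≥ n + 1` factors, the product is evaluated along a binary tree of depth `J
= O(1 + log n)`. Scalar products come from polarization and the sawtooth approximation of the
square, with error `4 ^ (-m)` at size and depth `O(m)`. Scaling all factors to entries at most `1/8`
makes the error bound `8 / 4 ^ m` reproduce itself at every tree level (`abs_treeApprox_sub_le`).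
Undoing the scaling costs a factor `(8M) ^ (2 ^ J)`, which `m = O(n log M - log ε)` absorbs. This
gives size `O(1 + n m)` and depth `O(1 + J m)`.

The argument is clipped to `[-M, M]`, so the factors are bounded for every `x`. The first factor is
a trapezoidal cutoff times the identity; where the cutoff vanishes the tree returns exactly zero,
because the approximate product with `0` is exactly `0` (`treeApprox_eq_zero`).

The `L²` error has three sources (`eLpNorm_normHermite_sub_le`): the uniform network error; the
ramps of the cutoff, of width `η` and hence of Gaussian mass at most `2η`; and the tail `|x| > M`,
where `|H_n(x)| ≤ (3|x|) ^ n` and a moment of the Gaussian tail is integrated in closed form. -/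

/-! ### Calculus of ReLU networks -/

/-- The number of nonzero entries of a weight matrix and a bias vector, for arbitrary finite
index types. -/
noncomputable def nonzeroCount {ι κ : Type} [Fintype ι] [Fintype κ] (W : Matrix κ ι ℝ)
    (b : κ → ℝ) : ℕ :=
  ∑ k, ((∑ i, if W k i ≠ 0 then 1 else 0) + if b k ≠ 0 then 1 else 0)

theorem FeedforwardNN.layerSize_eq {n m : ℕ} (W : Matrix (Fin m) (Fin n) ℝ) (b : Fin m → ℝ) :
    FeedforwardNN.layerSize W b = nonzeroCount W b := by
  simp only [FeedforwardNN.layerSize, nonzeroCount, Finset.card_filter, Finset.sum_add_distrib,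
    Fintype.sum_prod_type]

theorem nonzeroCount_le {ι κ : Type} [Fintype ι] [Fintype κ] (W : Matrix κ ι ℝ) (b : κ → ℝ) :
    nonzeroCount W b ≤ Fintype.card κ * (Fintype.card ι + 1) := by
  unfold nonzeroCount
  calc _ ≤ ∑ _k : κ, ((∑ _i : ι, 1) + 1) := by
        refine Finset.sum_le_sum fun k _ => add_le_add (Finset.sum_le_sum fun i _ => ?_) ?_ <;>
          split_ifs <;> simp
    _ = _ := by simp

/-- `ReluNet f d s` says that `f` is a composition of affine maps and componentwise ReLUs,
of depth `d` and size at most `s` after every signed quantity is carried as its positive and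
its negative part. -/
inductive ReluNet : ∀ {ι κ : Type} [Fintype ι] [Fintype κ],
    ((ι → ℝ) → κ → ℝ) → ℕ → ℕ → Prop
  | id {ι : Type} [Fintype ι] : ReluNet (fun x : ι → ℝ => x) 0 0
  | relu {ι : Type} [Fintype ι] :
      ReluNet (fun (x : ι → ℝ) i => max (x i) 0) 1 (Fintype.card ι)
  | affine {ι κ : Type} [Fintype ι] [Fintype κ] (W : Matrix κ ι ℝ) (b : κ → ℝ) :
      ReluNet (fun x => W.mulVec x + b) 1 (4 * nonzeroCount W b)
  | comp {ι κ μ : Type} [Fintype ι] [Fintype κ] [Fintype μ] {f : (ι → ℝ) → κ → ℝ}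
      {g : (κ → ℝ) → μ → ℝ} {d e s t : ℕ} (hf : ReluNet f d s) (hg : ReluNet g e t) :
      ReluNet (fun x => g (f x)) (d + e) (s + t)
  | mono {ι κ : Type} [Fintype ι] [Fintype κ] {f : (ι → ℝ) → κ → ℝ} {d s t : ℕ}
      (hf : ReluNet f d s) (hst : s ≤ t) : ReluNet f d t

namespace ReluNet

theorem of_linear {ι κ : Type} [Fintype ι] [Fintype κ] {f : (ι → ℝ) → κ → ℝ}
    (l : κ → ((ι → ℝ) →ₗ[ℝ] ℝ)) (b : κ → ℝ) (hf : ∀ x k, f x k = l k x + b k) :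
    ReluNet f 1 (4 * (Fintype.card κ * (Fintype.card ι + 1))) := by
  classical
  have h := ReluNet.affine (LinearMap.toMatrix' (LinearMap.pi l)) b
  have hfe : f = fun x => (LinearMap.toMatrix' (LinearMap.pi l)).mulVec x + b := by
    funext x k
    rw [LinearMap.toMatrix'_mulVec]
    simp [hf]
  rw [hfe]
  exact h.mono (Nat.mul_le_mul_left 4 (nonzeroCount_le _ _))

/-- Parallel copies use block diagonal weights, so the size is multiplied and the depth is
unchanged. -/
theorem copies {ι κ : Type} [Fintype ι] [Fintype κ] {f : (ι → ℝ) → κ → ℝ} {d s : ℕ}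
    (hf : ReluNet f d s) (τ : Type) [Fintype τ] :
    ReluNet (fun (X : τ × ι → ℝ) (p : τ × κ) => f (fun i => X (p.1, i)) p.2) d
      (Fintype.card τ * s) := by
  classical
  induction hf with
  | id => simpa using ReluNet.id
  | relu =>
    rw [← Fintype.card_prod]
    exact ReluNet.relu
  | @affine ι κ _ _ W b =>
    have h := ReluNet.affine (ι := τ × ι) (κ := τ × κ)
      (fun p q => if p.1 = q.1 then W p.2 q.2 else 0) (fun p => b p.2)
    have hn : nonzeroCount (ι := τ × ι) (κ := τ × κ)
        (fun p q => if p.1 = q.1 then W p.2 q.2 else 0) (fun p => b p.2) =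
        Fintype.card τ * nonzeroCount W b := by
      have hc : ∀ c : ℕ, ∑ _t : τ, c = Fintype.card τ * c := by simp
      rw [← hc]
      unfold nonzeroCount
      rw [Fintype.sum_prod_type]
      refine Finset.sum_congr rfl fun t _ => Finset.sum_congr rfl fun k _ => ?_
      congr 1
      rw [Fintype.sum_prod_type, Finset.sum_eq_single t]
      · simp
      · intro t' _ ht
        simp [ht.symm]
      · simp
    rw [hn] at h
    have hfun : (fun (X : τ × ι → ℝ) (p : τ × κ) =>
        (W.mulVec (fun i => X (p.1, i)) + b) p.2) =
        fun X => Matrix.mulVec (fun (p : τ × κ) (q : τ × ι) =>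
          if p.1 = q.1 then W p.2 q.2 else 0) X + fun p => b p.2 := by
      funext X p
      simp only [Pi.add_apply, Matrix.mulVec, dotProduct, Fintype.sum_prod_type]
      rw [Finset.sum_eq_single p.1]
      · simp
      · intro t' _ ht
        simp [ht.symm]
      · simp
    rw [hfun]
    exact h.mono (le_of_eq (by ring))
  | comp _ _ ihf ihg => exact (ihf.comp ihg).mono (le_of_eq (by ring))
  | mono _ hst ih => exact ih.mono (Nat.mul_le_mul_left _ hst)

end ReluNet

/-- The positive and negative parts of the coordinates of a vector. -/
noncomputable def signedParts {ι : Type} (x : ι → ℝ) (p : ι × Bool) : ℝ :=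
  max ((if p.2 then 1 else -1) * x p.1) 0

theorem signedParts_sub {ι : Type} (x : ι → ℝ) (i : ι) :
    signedParts x (i, true) - signedParts x (i, false) = x i := by
  simp only [signedParts, if_true, one_mul]
  rcases le_total (x i) 0 with h | h <;> simp [h]

open FeedforwardNN in
/-- A function given by `ReluNet` can be put in front of a feedforward network. -/
theorem ReluNet.exists_feedforwardNN {ι κ : Type} [Fintype ι] [Fintype κ]
    {f : (ι → ℝ) → κ → ℝ} {d s : ℕ} (hf : ReluNet f d s) {m K : ℕ} (e : κ × Bool ≃ Fin K)
    (Ψ : FeedforwardNN K m) :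
    ∃ (N : ℕ) (e' : ι × Bool ≃ Fin N) (Φ : FeedforwardNN N m),
      (∀ x, Φ.realize (fun t => max t 0) (fun i => signedParts x (e'.symm i)) =
        Ψ.realize (fun t => max t 0) (fun k => signedParts (f x) (e.symm k))) ∧
      Φ.depth = d + Ψ.depth ∧ Φ.size ≤ s + Ψ.size := by
  classical
  induction hf generalizing m K with
  | id => exact ⟨K, e, Ψ, fun _ => rfl, by simp, by simp⟩
  | @relu ι _ =>
    -- The ReLU of a coordinate is its positive part, whose own negative part is zero: keep the
    -- `true` entries and erase the others.
    let W : Matrix (Fin K) (Fin K) ℝ :=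
      fun p q => if p = q ∧ (e.symm p).2 = true then 1 else 0
    refine ⟨K, e, .hidden W 0 Ψ, fun x => ?_, by simp [FeedforwardNN.depth, add_comm], ?_⟩
    · simp only [FeedforwardNN.realize]
      congr 1
      funext p
      simp only [W, Matrix.mulVec, dotProduct, Pi.add_apply, Pi.zero_apply, add_zero]
      rw [Finset.sum_eq_single p (by intro q _ hq; simp [hq.symm]) (by simp)]
      rcases h : e.symm p with ⟨i, c⟩
      cases c <;> simp [signedParts]
    · simp only [FeedforwardNN.size]
      refine Nat.add_le_add_right ?_ _
      rw [layerSize_eq, nonzeroCount]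
      have : ∀ p, (∑ q, if W p q ≠ 0 then 1 else 0) + (if (0 : Fin K → ℝ) p ≠ 0 then 1 else 0) =
          if (e.symm p).2 = true then 1 else 0 := by
        intro p
        rw [Finset.sum_eq_single p (by intro q _ hq; simp [W, hq.symm]) (by simp)]
        simp [W]
      simp only [this]
      rw [Equiv.sum_comp e.symm (fun q : ι × Bool => if q.2 = true then 1 else 0),
        Fintype.sum_prod_type]
      simp
  | @affine ι κ _ _ W b =>
    let e' := Fintype.equivFin (ι × Bool)
    let sg : Bool → ℝ := fun c => if c then 1 else -1
    have hsg : ∀ c, sg c ≠ 0 := by intro c; cases c <;> simp [sg]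
    -- Signs at input and output turn each weight into four and each bias into two, hence the factor
    -- `4`. The affine map costs one layer because its output is again split by a ReLU.
    let V : Matrix (κ × Bool) (ι × Bool) ℝ := fun p q => sg p.2 * (sg q.2 * W p.1 q.1)
    let W' : Matrix (Fin K) (Fin _) ℝ := fun p q => V (e.symm p) (e'.symm q)
    let b' : Fin K → ℝ := fun p => sg (e.symm p).2 * b (e.symm p).1
    refine ⟨_, e', .hidden W' b' Ψ, fun x => ?_, by simp [FeedforwardNN.depth, add_comm], ?_⟩
    · simp only [FeedforwardNN.realize]
      congr 1
      funext p
      simp only [W', b', Matrix.mulVec, dotProduct, Pi.add_apply]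
      rw [Equiv.sum_comp e'.symm (fun q => V (e.symm p) q * signedParts x q),
        Fintype.sum_prod_type]
      have : ∀ i, (∑ c : Bool, V (e.symm p) (i, c) * signedParts x (i, c)) =
          sg (e.symm p).2 * (W (e.symm p).1 i * x i) := by
        intro i
        rw [Fintype.sum_bool, ← signedParts_sub x i]
        simp only [V, sg, if_true, Bool.false_eq_true, if_false]
        ring
      simp only [this, ← Finset.mul_sum, ← mul_add]
      rfl
    · simp only [FeedforwardNN.size]
      refine Nat.add_le_add_right ?_ _
      rw [layerSize_eq, nonzeroCount]
      have h1 : ∀ p, (∑ q, if W' p q ≠ 0 then 1 else 0) =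
          2 * ∑ i, if W (e.symm p).1 i ≠ 0 then 1 else 0 := by
        intro p
        simp only [W']
        rw [Equiv.sum_comp e'.symm (fun q => if V (e.symm p) q ≠ 0 then 1 else 0),
          Fintype.sum_prod_type, Finset.mul_sum]
        refine Finset.sum_congr rfl fun i _ => ?_
        simp [V, hsg]
      have h2 : ∀ p, (if b' p ≠ 0 then 1 else 0) = if b (e.symm p).1 ≠ 0 then 1 else 0 := by
        intro p
        simp [b', hsg]
      simp only [h1, h2]
      rw [Equiv.sum_comp e.symm (fun q : κ × Bool =>
        (2 * (∑ i, if W q.1 i ≠ 0 then 1 else 0) + if b q.1 ≠ 0 then 1 else 0)),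
        Fintype.sum_prod_type, nonzeroCount, Finset.mul_sum]
      refine Finset.sum_le_sum fun k _ => ?_
      simp only [Fintype.sum_bool]
      omega
  | comp _ _ ihf ihg =>
    obtain ⟨_, e₁, Φ₁, h₁, hd₁, hs₁⟩ := ihg e Ψ
    obtain ⟨N, e₂, Φ₂, h₂, hd₂, hs₂⟩ := ihf e₁ Φ₁
    exact ⟨N, e₂, Φ₂, fun x => (h₂ x).trans (h₁ _), by omega, by omega⟩
  | mono _ hst ih =>
    obtain ⟨N, e', Φ, h, hd, hs⟩ := ih e Ψ
    exact ⟨N, e', Φ, h, hd, by omega⟩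

open FeedforwardNN in
/-- A multiple of a coordinate of a `ReluNet` function of one variable is realized by a ReLU
network. -/
theorem ReluNet.exists_reluFun {κ : Type} [Fintype κ] {f : (Unit → ℝ) → κ → ℝ} {d s : ℕ}
    (hf : ReluNet f d s) (k : κ) (c : ℝ) :
    ∃ Φ : FeedforwardNN 1 1, (∀ x, Φ.reluFun x = c * f (fun _ => x) k) ∧
      Φ.depth = d + 1 ∧ Φ.size ≤ s + 2 * Fintype.card κ + 5 := by
  classical
  let e := Fintype.equivFin (κ × Bool)
  let Wout : Matrix (Fin 1) (Fin (Fintype.card (κ × Bool))) ℝ := fun _ q =>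
    if (e.symm q).1 = k then (if (e.symm q).2 then c else -c) else 0
  obtain ⟨N, e', Φ, h, hd, hs⟩ := hf.exists_feedforwardNN e (.output Wout 0)
  -- An initial layer `x ↦ (x, -x)` followed by ReLU creates the signed parts; it accounts for the
  -- extra unit of depth.
  let Win : Matrix (Fin N) (Fin 1) ℝ := fun p _ => if (e'.symm p).2 then 1 else -1
  have hN : N = 2 := by
    have := Fintype.card_congr e'
    simpa using this.symm
  refine ⟨.hidden Win 0 Φ, fun x => ?_, ?_, ?_⟩
  · have hx : (fun i => max ((Win.mulVec (fun _ => x) + 0) i) 0) =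
        fun i => signedParts (fun _ : Unit => x) (e'.symm i) := by
      funext i
      simp [Win, Matrix.mulVec, dotProduct, signedParts]
    simp only [reluFun, realize]
    rw [hx, h]
    simp only [realize, Matrix.mulVec, dotProduct, Pi.add_apply, Pi.zero_apply, add_zero, Wout]
    rw [Equiv.sum_comp e.symm (fun q : κ × Bool =>
      (if q.1 = k then (if q.2 then c else -c) else 0) *
        signedParts (f fun _ => x) q), Fintype.sum_prod_type, Finset.sum_eq_single k]
    · rw [Fintype.sum_bool, ← signedParts_sub (f fun _ => x) k]
      simp
      ring
    · intro i _ hi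
      simp [hi]
    · simp
  · simp [depth] at hd ⊢
    omega
  · simp only [size] at hs ⊢
    have h1 := nonzeroCount_le Wout 0
    have h2 := nonzeroCount_le Win 0
    rw [← layerSize_eq] at h1 h2
    simp at h1 h2
    subst hN
    omega

/-! ### Approximate squares and products -/

/-- The tent map, written with ReLUs; on `[0, 1]` it is `t ↦ 2 * min t (1 - t)`. -/
noncomputable def tent (t : ℝ) : ℝ := 2 * max t 0 - 4 * max (t - 1 / 2) 0

theorem tent_mem {t : ℝ} (h0 : 0 ≤ t) (h1 : t ≤ 1) : 0 ≤ tent t ∧ tent t ≤ 1 := by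
  unfold tent
  rw [max_eq_left h0]
  rcases max_cases (t - 1 / 2) 0 with ⟨h, h'⟩ | ⟨h, h'⟩ <;> rw [h] <;> constructor <;> linarith

/-- The self-similarity of `q(t) = t - t ^ 2` under the tent map `T`. Iterating it gives `t ^ 2 = t
- ∑ T^k(t) / 4 ^ k` with remainder `q(T^m(t)) / 4 ^ m`. -/
theorem sub_sq_eq_tent {t : ℝ} (h0 : 0 ≤ t) :
    t - t ^ 2 = (tent t + (tent t - tent t ^ 2)) / 4 := by
  unfold tent
  rw [max_eq_left h0]
  rcases max_cases (t - 1 / 2) 0 with ⟨h, h'⟩ | ⟨h, h'⟩ <;> rw [h] <;> ring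

/-- One step of the sawtooth recursion: apply the tent map and correct the accumulator. -/
noncomputable def sawtoothStep (c : ℝ) (x : Fin 2 → ℝ) : Fin 2 → ℝ :=
  ![tent (x 0), max (x 1) 0 - c * tent (x 0)]

/-- A coordinate as a linear form. -/
def coordForm {ι : Type} (i : ι) : (ι → ℝ) →ₗ[ℝ] ℝ := LinearMap.proj i

@[simp]
theorem coordForm_apply {ι : Type} (i : ι) (x : ι → ℝ) : coordForm i x = x i := rfl

theorem reluNet_sawtoothStep (c : ℝ) : ReluNet (sawtoothStep c) 3 87 := by
  have h1 : ReluNet (fun (x : Fin 2 → ℝ) => ![x 0, x 0 - 1 / 2, x 1]) 1 36 := by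
    refine (ReluNet.of_linear (f := fun (x : Fin 2 → ℝ) => ![x 0, x 0 - 1 / 2, x 1])
      ![coordForm 0, coordForm 0, coordForm 1]
      ![0, -1 / 2, 0] ?_).mono (by simp)
    intro x k
    fin_cases k <;> simp
    ring
  have h2 : ReluNet (fun (x : Fin 3 → ℝ) => ![2 * x 0 - 4 * x 1, x 2 - c * (2 * x 0 - 4 * x 1)])
      1 32 := by
    refine (ReluNet.of_linear
      (f := fun (x : Fin 3 → ℝ) => ![2 * x 0 - 4 * x 1, x 2 - c * (2 * x 0 - 4 * x 1)])
      ![(2 : ℝ) • coordForm 0 - (4 : ℝ) • coordForm 1,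
        coordForm 2 - c • ((2 : ℝ) • coordForm 0 - (4 : ℝ) • coordForm 1)]
      0 ?_).mono (by simp)
    intro x k
    fin_cases k <;> simp
  refine (((h1.comp ReluNet.relu).comp h2).mono (by simp) : ReluNet _ 3 87)

/-- The iterated sawtooth recursion. -/
noncomputable def sawtoothIter : ℕ → (Fin 2 → ℝ) → Fin 2 → ℝ
  | 0, x => x
  | k + 1, x => sawtoothStep (1 / 4 ^ (k + 1)) (sawtoothIter k x)

theorem reluNet_sawtoothIter (m : ℕ) : ReluNet (sawtoothIter m) (3 * m) (87 * m) := by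
  induction m with
  | zero => exact ReluNet.id
  | succ k ih => exact ih.comp (reluNet_sawtoothStep _)

/-- Yarotsky's approximation of `t ^ 2`. -/
noncomputable def sqApprox (m : ℕ) (t : ℝ) : ℝ := sawtoothIter m (fun _ => t) 1

theorem sawtoothIter_spec {t : ℝ} (h0 : 0 ≤ t) (h1 : t ≤ 1) (m : ℕ) :
    0 ≤ sawtoothIter m (fun _ => t) 0 ∧ sawtoothIter m (fun _ => t) 0 ≤ 1 ∧
      sawtoothIter m (fun _ => t) 1 = t ^ 2 +
        (sawtoothIter m (fun _ => t) 0 - sawtoothIter m (fun _ => t) 0 ^ 2) / 4 ^ m := by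
  induction m with
  | zero => exact ⟨h0, h1, by simp [sawtoothIter]⟩
  | succ k ih =>
    obtain ⟨i0, i1, i2⟩ := ih
    set z := sawtoothIter k (fun _ => t) 0 with hz
    have hT := tent_mem i0 i1
    refine ⟨hT.1, hT.2, ?_⟩
    -- The ReLU acts on every coordinate of the layer; on the accumulator it is the identity,
    -- because this is at least `t ^ 2`.
    have hpos : 0 ≤ sawtoothIter k (fun _ => t) 1 := by
      rw [i2]
      have : 0 ≤ z - z ^ 2 := by nlinarith
      positivity
    change max (sawtoothIter k (fun _ => t) 1) 0 - 1 / 4 ^ (k + 1) * tent z =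
      t ^ 2 + (tent z - tent z ^ 2) / 4 ^ (k + 1)
    rw [max_eq_left hpos, i2, sub_sq_eq_tent i0]
    field_simp
    ring

theorem sqApprox_mem {t : ℝ} (h0 : 0 ≤ t) (h1 : t ≤ 1) (m : ℕ) :
    t ^ 2 ≤ sqApprox m t ∧ sqApprox m t ≤ t ^ 2 + 1 / 4 ^ m := by
  obtain ⟨i0, i1, i2⟩ := sawtoothIter_spec h0 h1 m
  unfold sqApprox
  rw [i2]
  set z := sawtoothIter m (fun _ => t) 0
  have hz : 0 ≤ z - z ^ 2 := by nlinarith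
  constructor
  · have : 0 ≤ (z - z ^ 2) / 4 ^ m := by positivity
    linarith
  · have : (z - z ^ 2) / 4 ^ m ≤ 1 / 4 ^ m := by
      gcongr
      nlinarith
    linarith

/-- The approximate product of two numbers in `[-1, 1]`. -/
noncomputable def mulApprox (m : ℕ) (a b : ℝ) : ℝ :=
  sqApprox m (|a + b| / 2) - sqApprox m (|a - b| / 2)

@[simp]
-- The two approximate squares coincide and cancel exactly; this makes the final network vanish
-- outside `[-M, M]`.
theorem mulApprox_zero_left (m : ℕ) (b : ℝ) : mulApprox m 0 b = 0 := by
  simp [mulApprox]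

/-- Polarization. Both squares are overestimated by at most `4 ^ (-m)`, so the errors do not add up
in the difference. -/
theorem abs_mulApprox_sub_le {a b : ℝ} (ha : |a| ≤ 1) (hb : |b| ≤ 1) (m : ℕ) :
    |mulApprox m a b - a * b| ≤ 1 / 4 ^ m := by
  have h1 := sqApprox_mem (t := |a + b| / 2) (by positivity)
    (by linarith [abs_add_le a b]) m
  have h2 := sqApprox_mem (t := |a - b| / 2) (by positivity)
    (by linarith [abs_sub a b]) m
  have e : a * b = (|a + b| / 2) ^ 2 - (|a - b| / 2) ^ 2 := by
    rw [div_pow, div_pow, sq_abs, sq_abs]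
    ring
  rw [e, mulApprox, abs_le]
  constructor <;> linarith

theorem max_add_max_neg (x : ℝ) : max x 0 + max (-x) 0 = |x| := by
  rcases le_total x 0 with h | h
  · simp [h, abs_of_nonpos h]
  · simp [h, abs_of_nonneg h]

theorem reluNet_mulApprox (m : ℕ) :
    ReluNet (fun (x : Fin 2 → ℝ) (_ : Unit) => mulApprox m (x 0) (x 1)) (3 * m + 4)
      (174 * m + 152) := by
  have h1 : ReluNet (fun (x : Fin 2 → ℝ) (p : Bool × Bool) =>
      (if p.2 then (1 : ℝ) else -1) * (x 0 + (if p.1 then 1 else -1) * x 1)) 1 48 := by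
    refine (ReluNet.of_linear (fun p : Bool × Bool => (if p.2 then (1 : ℝ) else -1) •
      (coordForm 0 + (if p.1 then (1 : ℝ) else -1) • coordForm 1)) 0 ?_).mono (by simp)
    intro x p
    simp only [LinearMap.smul_apply, LinearMap.add_apply, coordForm_apply, smul_eq_mul,
      Pi.zero_apply, add_zero]
  -- Positive plus negative part is the absolute value. The index `Fin 2` duplicates it, since the
  -- sawtooth recursion starts from `(t, t)`.
  have h2 : ReluNet (fun (x : Bool × Bool → ℝ) (p : Bool × Fin 2) =>
      (x (p.1, true) + x (p.1, false)) / 2) 1 80 := by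
    refine (ReluNet.of_linear (fun p : Bool × Fin 2 => (1 / 2 : ℝ) •
      (coordForm (p.1, true) + coordForm (p.1, false))) 0 ?_).mono (by simp)
    intro x p
    simp
    ring
  have h3 : ReluNet (fun (x : Bool × Fin 2 → ℝ) (_ : Unit) => x (true, 1) - x (false, 1))
      1 20 := by
    refine (ReluNet.of_linear (fun _ : Unit =>
      (coordForm (true, 1) - coordForm (false, 1))) 0 ?_).mono (by simp)
    intro x p
    simp
  have h := ((((h1.comp ReluNet.relu).comp h2).comp
    ((reluNet_sawtoothIter m).copies Bool)).comp h3).mono (t := 174 * m + 152)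
    (by simp; omega)
  rw [show 3 * m + 4 = 1 + 1 + 1 + 3 * m + 1 by ring]
  convert h using 3 with x
  simp only [mulApprox, sqApprox, ← max_add_max_neg]
  simp [sub_eq_add_neg]

/-! ### Matrix products along a binary tree -/

/-- The approximate product of two `2 × 2` matrices, given as one vector. -/
noncomputable def matMulApprox (m : ℕ) (X : Bool × (Fin 2 × Fin 2) → ℝ) (p : Fin 2 × Fin 2) : ℝ :=
  ∑ j, mulApprox m (X (false, (p.1, j))) (X (true, (j, p.2)))

theorem reluNet_matMulApprox (m : ℕ) :
    ReluNet (matMulApprox m) (3 * m + 6) (1392 * m + 2000) := by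
  -- Routes the entries to the eight scalar products, which then run in parallel.
  have h1 : ReluNet (fun (X : Bool × (Fin 2 × Fin 2) → ℝ) (q : (Fin 2 × Fin 2 × Fin 2) × Fin 2) =>
      if q.2 = 0 then X (false, (q.1.1, q.1.2.1)) else X (true, (q.1.2.1, q.1.2.2)))
      1 576 := by
    refine (ReluNet.of_linear (fun q : (Fin 2 × Fin 2 × Fin 2) × Fin 2 =>
      if q.2 = 0 then coordForm (false, (q.1.1, q.1.2.1))
      else coordForm (true, (q.1.2.1, q.1.2.2))) 0 ?_).mono (by simp)
    intro X q
    split_ifs <;> simp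
  have h2 : ReluNet (fun (X : (Fin 2 × Fin 2 × Fin 2) × Unit → ℝ) (p : Fin 2 × Fin 2) =>
      ∑ j, X ((p.1, j, p.2), ())) 1 144 := by
    refine (ReluNet.of_linear (fun p : Fin 2 × Fin 2 =>
      ∑ j, coordForm ((p.1, j, p.2), ())) 0 ?_).mono (by simp)
    intro X p
    simp
  have h := ((h1.comp ((reluNet_mulApprox m).copies (Fin 2 × Fin 2 × Fin 2))).comp h2).mono
    (t := 1392 * m + 2000) (by simp; omega)
  rw [show 3 * m + 6 = 1 + (3 * m + 4) + 1 by ring]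
  convert h using 3 with X p
  simp [matMulApprox]

/-- The coordinates of `2 ^ j` matrices of size `2 × 2`, arranged in a binary tree. -/
def TreeIndex : ℕ → Type
  | 0 => Fin 2 × Fin 2
  | j + 1 => Bool × TreeIndex j

instance instFintypeTreeIndex : ∀ j, Fintype (TreeIndex j)
  | 0 => inferInstanceAs (Fintype (Fin 2 × Fin 2))
  | j + 1 =>
    letI := instFintypeTreeIndex j
    inferInstanceAs (Fintype (Bool × TreeIndex j))

theorem card_treeIndex (j : ℕ) : Fintype.card (TreeIndex j) = 4 * 2 ^ j := by
  induction j with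
  | zero => rfl
  | succ j ih =>
    have : Fintype.card (TreeIndex (j + 1)) = Fintype.card (Bool × TreeIndex j) := rfl
    rw [this, Fintype.card_prod, ih, Fintype.card_bool]
    ring

/-- The number of the matrix that a coordinate of the tree belongs to, and its place there. -/
def TreeIndex.leaf : ∀ j, TreeIndex j → ℕ × (Fin 2 × Fin 2)
  | 0, s => (0, s)
  | j + 1, i => ((TreeIndex.leaf j i.2).1 + (if i.1 then 2 ^ j else 0), (TreeIndex.leaf j i.2).2)

/-- The approximate product of `2 ^ j` matrices along a binary tree. -/
noncomputable def treeApprox (m : ℕ) : ∀ j, (TreeIndex j → ℝ) → Fin 2 × Fin 2 → ℝ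
  | 0, X => X
  | j + 1, X => matMulApprox m fun p => treeApprox m j (fun i => X (p.1, i)) p.2

theorem reluNet_treeApprox (m j : ℕ) :
    ReluNet (treeApprox m j) (j * (3 * m + 6)) ((2 ^ j - 1) * (1392 * m + 2000)) := by
  induction j with
  | zero =>
    have h : ReluNet (treeApprox m 0) 0 0 := ReluNet.id (ι := Fin 2 × Fin 2)
    simpa using h
  | succ j ih =>
    have h := (ih.copies Bool).comp (reluNet_matMulApprox m)
    rw [show (j + 1) * (3 * m + 6) = j * (3 * m + 6) + (3 * m + 6) by ring]
    refine h.mono (le_of_eq ?_)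
    have : 2 ^ (j + 1) - 1 = 2 * (2 ^ j - 1) + 1 := by
      have := Nat.one_le_two_pow (n := j)
      omega
    rw [this, Fintype.card_bool]
    ring

/-- The entries of the first `2 ^ j` matrices of a sequence, as a tree. -/
def treeOfSeq {α : Type} (L : ℕ → Matrix (Fin 2) (Fin 2) α) (j : ℕ) (i : TreeIndex j) : α :=
  L (TreeIndex.leaf j i).1 (TreeIndex.leaf j i).2.1 (TreeIndex.leaf j i).2.2

/-- The product of the first `N` matrices of a sequence. -/
def seqProd (L : ℕ → Matrix (Fin 2) (Fin 2) ℝ) (N : ℕ) : Matrix (Fin 2) (Fin 2) ℝ :=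
  ((List.range N).map L).prod

theorem seqProd_succ (L : ℕ → Matrix (Fin 2) (Fin 2) ℝ) (N : ℕ) :
    seqProd L (N + 1) = seqProd L N * L N := by
  simp [seqProd, List.range_succ]

theorem seqProd_add (L : ℕ → Matrix (Fin 2) (Fin 2) ℝ) (a b : ℕ) :
    seqProd L (a + b) = seqProd L a * seqProd (fun k => L (k + a)) b := by
  simp only [seqProd, List.range_add, List.map_append, List.prod_append, List.map_map]
  congr 4
  funext k
  simp [add_comm]

theorem treeOfSeq_false {α : Type} (L : ℕ → Matrix (Fin 2) (Fin 2) α) (j : ℕ) :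
    (fun i => treeOfSeq L (j + 1) (false, i)) = treeOfSeq L j := by
  funext i
  simp [treeOfSeq, TreeIndex.leaf]

theorem treeOfSeq_true {α : Type} (L : ℕ → Matrix (Fin 2) (Fin 2) α) (j : ℕ) :
    (fun i => treeOfSeq L (j + 1) (true, i)) = treeOfSeq (fun k => L (k + 2 ^ j)) j := by
  funext i
  simp [treeOfSeq, TreeIndex.leaf]

theorem treeApprox_succ (m : ℕ) (L : ℕ → Matrix (Fin 2) (Fin 2) ℝ) (j : ℕ) (p : Fin 2 × Fin 2) :
    treeApprox m (j + 1) (treeOfSeq L (j + 1)) p =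
      ∑ k, mulApprox m (treeApprox m j (treeOfSeq L j) (p.1, k))
        (treeApprox m j (treeOfSeq (fun k => L (k + 2 ^ j)) j) (k, p.2)) := by
  rw [← treeOfSeq_false, ← treeOfSeq_true]
  rfl

theorem treeApprox_eq_zero (m : ℕ) (L : ℕ → Matrix (Fin 2) (Fin 2) ℝ) (hL : L 0 = 0) (j : ℕ)
    (p : Fin 2 × Fin 2) : treeApprox m j (treeOfSeq L j) p = 0 := by
  induction j generalizing p with
  | zero => simp [treeApprox, treeOfSeq, TreeIndex.leaf, hL]
  | succ j ih => simp [treeApprox_succ, ih]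

/-- The bound is independent of `j`. With `δ = 4 ^ (-m)`, each of the two products in an entry errs
by at most `δ + (1/4) * 8δ + 8δ * (1/8) = 4δ`, so the entry again errs by at most `8δ`. The
condition `3 ≤ m` gives `8δ ≤ 1/8`, which keeps approximate entries below `1/4`. -/
theorem abs_treeApprox_sub_le {m : ℕ} (hm : 3 ≤ m) (j : ℕ)
    (L : ℕ → Matrix (Fin 2) (Fin 2) ℝ) (hL : ∀ k a b, |L k a b| ≤ 1 / 8) (a b : Fin 2) :
    |seqProd L (2 ^ j) a b| ≤ 1 / 8 ∧
      |treeApprox m j (treeOfSeq L j) (a, b) - seqProd L (2 ^ j) a b| ≤ 8 / 4 ^ m := by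
  have hδ : (8 : ℝ) / 4 ^ m ≤ 1 / 8 := by
    have : (4 : ℝ) ^ 3 ≤ 4 ^ m := pow_le_pow_right₀ (by norm_num) hm
    rw [div_le_div_iff₀ (by positivity) (by norm_num)]
    linarith
  induction j generalizing L a b with
  | zero =>
    have h1 : seqProd L (2 ^ 0) a b = L 0 a b := by simp [seqProd]
    have h2 : treeApprox m 0 (treeOfSeq L 0) (a, b) = L 0 a b := by
      simp [treeApprox, treeOfSeq, TreeIndex.leaf]
    rw [h1, h2]
    refine ⟨hL 0 a b, ?_⟩
    rw [sub_self, abs_zero]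
    positivity
  | succ j ih =>
    have e : seqProd L (2 ^ (j + 1)) a b = ∑ k, seqProd L (2 ^ j) a k *
        seqProd (fun k => L (k + 2 ^ j)) (2 ^ j) k b := by
      rw [pow_succ, mul_two, seqProd_add, Matrix.mul_apply]
    rw [treeApprox_succ, e]
    have key : ∀ k, |seqProd L (2 ^ j) a k * seqProd (fun k => L (k + 2 ^ j)) (2 ^ j) k b| ≤
        1 / 16 ∧ |mulApprox m (treeApprox m j (treeOfSeq L j) (a, k))
        (treeApprox m j (treeOfSeq (fun k => L (k + 2 ^ j)) j) (k, b)) -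
        seqProd L (2 ^ j) a k * seqProd (fun k => L (k + 2 ^ j)) (2 ^ j) k b| ≤ 4 / 4 ^ m := by
      intro k
      obtain ⟨u1, u2⟩ := ih L hL a k
      obtain ⟨v1, v2⟩ := ih (fun k => L (k + 2 ^ j)) (fun k => hL _) k b
      set u := seqProd L (2 ^ j) a k
      set v := seqProd (fun k => L (k + 2 ^ j)) (2 ^ j) k b
      set u' := treeApprox m j (treeOfSeq L j) (a, k)
      set v' := treeApprox m j (treeOfSeq (fun k => L (k + 2 ^ j)) j) (k, b)
      have hu' : |u'| ≤ 1 / 4 := by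
        have := abs_sub_abs_le_abs_sub u' u
        linarith
      have hv' : |v'| ≤ 1 / 4 := by
        have := abs_sub_abs_le_abs_sub v' v
        linarith
      have hm1 := abs_mulApprox_sub_le (a := u') (b := v') (by linarith) (by linarith) m
      constructor
      · rw [abs_mul]
        nlinarith [abs_nonneg u, abs_nonneg v]
      · have e1 : mulApprox m u' v' - u * v =
            (mulApprox m u' v' - u' * v') + u' * (v' - v) + (u' - u) * v := by ring
        rw [e1]
        refine (abs_add_three _ _ _).trans ?_
        rw [abs_mul, abs_mul]
        have t1 : |u'| * |v' - v| ≤ 1 / 4 * (8 / 4 ^ m) := by gcongr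
        have t2 : |u' - u| * |v| ≤ (8 / 4 ^ m) * (1 / 8) := by gcongr
        have t3 : (8 : ℝ) / 4 ^ m = 8 * (1 / 4 ^ m) := by ring
        have t4 : (4 : ℝ) / 4 ^ m = 4 * (1 / 4 ^ m) := by ring
        rw [t3] at t1 t2
        rw [t4]
        linarith
    obtain ⟨p1, p2⟩ := key 0
    obtain ⟨q1, q2⟩ := key 1
    rw [Fin.sum_univ_two, Fin.sum_univ_two]
    constructor
    · exact (abs_add_le _ _).trans (by linarith)
    · rw [add_sub_add_comm]
      refine (abs_add_le _ _).trans ?_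
      have t3 : (8 : ℝ) / 4 ^ m = 4 / 4 ^ m + 4 / 4 ^ m := by ring
      linarith

/-! ### Hermite recurrence and its matrix form -/

open Polynomial in
theorem Polynomial.derivative_hermite_succ (n : ℕ) :
    derivative (hermite (n + 1)) = ((n : ℤ[X]) + 1) * hermite n := by
  induction n with
  | zero => simp
  | succ n ih =>
    rw [hermite_succ (n + 1), derivative_sub, derivative_mul, derivative_X, ih, derivative_mul]
    have : derivative ((n : ℤ[X]) + 1) = 0 := by simp
    rw [this, hermite_succ n]
    push_cast
    ring

/-- The polynomial `hermite n`, evaluated at a real number. -/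
noncomputable def hermiteEval (n : ℕ) (x : ℝ) : ℝ := Polynomial.aeval x (Polynomial.hermite n)

theorem hermiteEval_succ_succ (n : ℕ) (x : ℝ) :
    hermiteEval (n + 2) x = x * hermiteEval (n + 1) x - (n + 1) * hermiteEval n x := by
  unfold hermiteEval
  rw [Polynomial.hermite_succ (n + 1), Polynomial.derivative_hermite_succ]
  simp

theorem normHermite_zero (x : ℝ) : normHermite 0 x = 1 := by
  simp [normHermite]

/-- The three-term recurrence; for `n = 0` the last term vanishes. -/
theorem normHermite_succ (n : ℕ) (x : ℝ) :
    Real.sqrt (n + 1) * normHermite (n + 1) x =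
      x * normHermite n x - Real.sqrt n * normHermite (n - 1) x := by
  have hs : ∀ k : ℕ, Real.sqrt ((k + 1).factorial : ℝ) =
      Real.sqrt (k + 1) * Real.sqrt (k.factorial : ℝ) := by
    intro k
    rw [Nat.factorial_succ, Nat.cast_mul, Real.sqrt_mul (by positivity)]
    push_cast
    rfl
  have hp : ∀ k : ℕ, 0 < Real.sqrt ((k : ℝ) + 1) := fun k => Real.sqrt_pos.2 (by positivity)
  have hf : ∀ k : ℕ, 0 < Real.sqrt (k.factorial : ℝ) := fun k => Real.sqrt_pos.2 (by positivity)
  cases n with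
  | zero => simp [normHermite]
  | succ n =>
    have h := hermiteEval_succ_succ n x
    unfold hermiteEval at h
    have h1 := (hp n).ne'
    have h2 := (hp (n + 1)).ne'
    have h3 := (hf n).ne'
    have hq : Real.sqrt ((n : ℝ) + 1) ^ 2 = n + 1 := Real.sq_sqrt (by positivity)
    simp only [normHermite, Nat.add_sub_cancel]
    rw [show n + 1 + 1 = n + 2 by rfl] at *
    rw [h, hs (n + 1), hs n]
    push_cast at h2 ⊢
    field_simp
    rw [hq]
    ring

theorem abs_normHermite_succ_le (n : ℕ) (x : ℝ) :
    |normHermite (n + 1) x| ≤ |x| * |normHermite n x| + |normHermite (n - 1) x| := by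
  have h := normHermite_succ n x
  have h1 : 1 ≤ Real.sqrt ((n : ℝ) + 1) := Real.one_le_sqrt.2 (by linarith [n.cast_nonneg (α := ℝ)])
  have h2 : Real.sqrt (n : ℝ) ≤ Real.sqrt ((n : ℝ) + 1) := Real.sqrt_le_sqrt (by linarith)
  have h3 : Real.sqrt ((n : ℝ) + 1) * |normHermite (n + 1) x| ≤
      |x| * |normHermite n x| + Real.sqrt n * |normHermite (n - 1) x| := by
    rw [← abs_of_pos (lt_of_lt_of_le one_pos h1), ← abs_mul, h, ← abs_mul]
    refine (abs_sub _ _).trans ?_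
    rw [abs_mul (Real.sqrt _), abs_of_nonneg (Real.sqrt_nonneg _)]
  have h4 : |x| * |normHermite n x| ≤ Real.sqrt ((n : ℝ) + 1) * (|x| * |normHermite n x|) :=
    le_mul_of_one_le_left (by positivity) h1
  have h5 : Real.sqrt n * |normHermite (n - 1) x| ≤
      Real.sqrt ((n : ℝ) + 1) * |normHermite (n - 1) x| := by gcongr
  refine le_of_mul_le_mul_left ?_ (lt_of_lt_of_le one_pos h1)
  linarith

/-- By the recurrence the next value is at most `(R + 1) * (3R) ^ n`, and `R + 1 ≤ 3R`. -/
theorem abs_normHermite_le {R : ℝ} (hR : 1 ≤ R) {x : ℝ} (hx : |x| ≤ R) (n : ℕ) :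
    |normHermite n x| ≤ (3 * R) ^ n := by
  induction n using Nat.strong_induction_on with
  | _ n ih =>
    rcases n with _ | n
    · simp [normHermite_zero]
    · have h1 := ih n (by omega)
      have h2 := ih (n - 1) (by omega)
      have h3 : (3 * R) ^ (n - 1) ≤ (3 * R) ^ n := pow_le_pow_right₀ (by linarith) (by omega)
      have h4 : 0 < (3 * R) ^ n := by positivity
      have h5 : |x| * |normHermite n x| ≤ R * (3 * R) ^ n := by gcongr
      have h6 := abs_normHermite_succ_le n x
      rw [pow_succ]
      nlinarith

/-- Matrices whose product in the upper left corner is `τ * normHermite n y`. -/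
noncomputable def hermiteFactor (n : ℕ) (τ y : ℝ) : ℕ → Matrix (Fin 2) (Fin 2) ℝ
  | 0 => τ • 1
  | k + 1 => if k < n then !![y / Real.sqrt (k + 1), 1; -(Real.sqrt k / Real.sqrt (k + 1)), 0]
      else 1

/-- Being affine in `(τ, y)`, all leaves of the tree are produced by a single layer. -/
theorem hermiteFactor_affine (n k : ℕ) (a b : Fin 2) :
    ∃ p q r : ℝ, ∀ τ y, hermiteFactor n τ y k a b = p * τ + q * y + r := by
  rcases k with _ | k
  · exact ⟨(1 : Matrix (Fin 2) (Fin 2) ℝ) a b, 0, 0, fun τ y => by simp [hermiteFactor, mul_comm]⟩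
  · by_cases hk : k < n
    · refine ⟨0, !![1 / Real.sqrt (k + 1), 0; 0, 0] a b,
        !![0, 1; -(Real.sqrt k / Real.sqrt (k + 1)), 0] a b, fun τ y => ?_⟩
      simp only [hermiteFactor, hk, if_true]
      fin_cases a <;> fin_cases b <;> simp
      ring
    · exact ⟨0, 0, (1 : Matrix (Fin 2) (Fin 2) ℝ) a b, fun τ y => by simp [hermiteFactor, hk]⟩

theorem abs_hermiteFactor_le {n : ℕ} {τ y M : ℝ} (hM : 1 ≤ M) (hτ : |τ| ≤ 1) (hy : |y| ≤ M)
    (k : ℕ) (a b : Fin 2) : |hermiteFactor n τ y k a b| ≤ M := by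
  have h1 : ∀ a b : Fin 2, |(1 : Matrix (Fin 2) (Fin 2) ℝ) a b| ≤ 1 := by
    intro a b
    rw [Matrix.one_apply]
    split_ifs <;> simp
  rcases k with _ | k
  · simp only [hermiteFactor, Matrix.smul_apply, smul_eq_mul, abs_mul]
    calc _ ≤ (1 : ℝ) * 1 := mul_le_mul hτ (h1 a b) (abs_nonneg _) zero_le_one
      _ ≤ M := by linarith
  · by_cases hk : k < n
    · simp only [hermiteFactor, hk, if_true]
      have hs : 1 ≤ Real.sqrt ((k : ℝ) + 1) :=
        Real.one_le_sqrt.2 (by linarith [k.cast_nonneg (α := ℝ)])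
      have hs2 : Real.sqrt (k : ℝ) ≤ Real.sqrt ((k : ℝ) + 1) := Real.sqrt_le_sqrt (by linarith)
      have e1 : |y / Real.sqrt (k + 1)| ≤ M := by
        rw [abs_div, abs_of_pos (lt_of_lt_of_le one_pos hs)]
        exact (div_le_self (abs_nonneg _) hs).trans hy
      have e2 : |Real.sqrt k / Real.sqrt (k + 1)| ≤ M := by
        rw [abs_of_nonneg (by positivity)]
        exact (div_le_one_of_le₀ hs2 (Real.sqrt_nonneg _)).trans hM
      fin_cases a <;> fin_cases b <;> simp
      · exact e1
      · exact hM
      · exact e2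
      · linarith
    · simp only [hermiteFactor, hk, if_false]
      exact (h1 a b).trans hM

/-- The first row of the partial product is `τ (H_k, H_{k-1})`. The factor `√k` removes the case `k
= 0`, where the second entry is `0` but `normHermite (0 - 1)` is `1`. -/
theorem seqProd_hermiteFactor_of_le {n k : ℕ} (τ y : ℝ) (hk : k ≤ n) :
    seqProd (hermiteFactor n τ y) (k + 1) 0 0 = τ * normHermite k y ∧
      seqProd (hermiteFactor n τ y) (k + 1) 0 1 * Real.sqrt k =
        τ * normHermite (k - 1) y * Real.sqrt k := by
  induction k with
  | zero => simp [seqProd, hermiteFactor, normHermite_zero]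
  | succ k ih =>
    obtain ⟨h1, h2⟩ := ih (by omega)
    have hs : 0 < Real.sqrt ((k : ℝ) + 1) := Real.sqrt_pos.2 (by positivity)
    have hr := normHermite_succ k y
    have hk' : k < n := by omega
    rw [seqProd_succ, Matrix.mul_apply, Matrix.mul_apply]
    simp only [Fin.sum_univ_two, hermiteFactor, hk', if_true, h1]
    constructor
    · have : normHermite (k + 1) y =
          (y * normHermite k y - Real.sqrt k * normHermite (k - 1) y) / Real.sqrt (k + 1) := by
        rw [← hr]
        field_simp
      rw [this]
      simp
      field_simp
      linear_combination (-1 : ℝ) * h2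
    · simp

theorem seqProd_hermiteFactor {n N : ℕ} (τ y : ℝ) (hN : n + 1 ≤ N) :
    seqProd (hermiteFactor n τ y) N 0 0 = τ * normHermite n y := by
  induction N, hN using Nat.le_induction with
  | base => exact (seqProd_hermiteFactor_of_le τ y le_rfl).1
  | succ N hN ih =>
    obtain ⟨k, rfl⟩ : ∃ k, N = k + 1 := ⟨N - 1, by omega⟩
    have : ¬ k < n := by omega
    rw [seqProd_succ]
    conv_lhs => rw [show hermiteFactor n τ y (k + 1) = 1 by simp [hermiteFactor, this]]
    rw [mul_one, ih]

theorem seqProd_smul (c : ℝ) (L : ℕ → Matrix (Fin 2) (Fin 2) ℝ) (N : ℕ) :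
    seqProd (fun k => c • L k) N = c ^ N • seqProd L N := by
  induction N with
  | zero => simp [seqProd]
  | succ N ih =>
    rw [seqProd_succ, seqProd_succ, ih, smul_mul_smul_comm, pow_succ]

/-! ### Gaussian tail moments -/

open MeasureTheory ProbabilityTheory Filter Topology

/-- The polynomial `Q` with `(-Q e^{-x²/2})' = x^{2n+1} e^{-x²/2}`. -/
noncomputable def oddMomentPoly : ℕ → Polynomial ℝ
  | 0 => 1
  | n + 1 => Polynomial.X ^ (2 * n + 2) + Polynomial.C (2 * (n : ℝ) + 2) * oddMomentPoly n

theorem derivative_oddMomentPoly (n : ℕ) :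
    Polynomial.X * oddMomentPoly n - Polynomial.derivative (oddMomentPoly n) =
      Polynomial.X ^ (2 * n + 1) := by
  induction n with
  | zero => simp [oddMomentPoly]
  | succ n ih =>
    simp only [oddMomentPoly, Polynomial.derivative_add, Polynomial.derivative_C_mul,
      Polynomial.derivative_X_pow]
    have h : Polynomial.X * oddMomentPoly n =
        Polynomial.derivative (oddMomentPoly n) + Polynomial.X ^ (2 * n + 1) := by
      rw [← ih]
      ring
    rw [mul_add, mul_left_comm, h]
    push_cast
    simp only [map_add, map_mul, map_natCast, map_ofNat]
    ring

/-- In the inductive step the two summands are at most a half and a quarter of the target, by `2 ≤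
(2n+2) (2n)!!` and `4 ≤ M ^ 2`. -/
theorem oddMomentPoly_eval_le {M : ℝ} (hM : 2 ≤ M) (n : ℕ) :
    (oddMomentPoly n).eval M ≤ (2 * n).doubleFactorial * M ^ (2 * n) := by
  induction n with
  | zero => simp [oddMomentPoly]
  | succ n ih =>
    have hM2 : 4 ≤ M ^ 2 := by nlinarith
    have hD : (1 : ℝ) ≤ (2 * n).doubleFactorial := by
      exact_mod_cast Nat.doubleFactorial_pos (2 * n)
    have hP : 0 < M ^ (2 * n) := by positivity
    have e : (2 * (n + 1)).doubleFactorial = (2 * n + 2) * (2 * n).doubleFactorial := by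
      rw [show 2 * (n + 1) = 2 * n + 2 by ring, Nat.doubleFactorial_add_two]
    rw [e]
    simp only [oddMomentPoly, Polynomial.eval_add, Polynomial.eval_pow, Polynomial.eval_X,
      Polynomial.eval_mul, Polynomial.eval_C]
    push_cast
    have h1 : (2 * (n : ℝ) + 2) * (oddMomentPoly n).eval M ≤
        (2 * (n : ℝ) + 2) * ((2 * n).doubleFactorial * M ^ (2 * n)) := by gcongr
    have e2 : M ^ (2 * (n + 1)) = M ^ (2 * n) * M ^ 2 := by ring
    have e3 : M ^ (2 * n + 2) = M ^ (2 * n) * M ^ 2 := by ring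
    rw [e2, e3]
    set D : ℝ := ((2 * n).doubleFactorial : ℝ)
    set P := M ^ (2 * n)
    have hn : (0 : ℝ) ≤ n := n.cast_nonneg
    have hA : 2 ≤ (2 * (n : ℝ) + 2) * D := by nlinarith
    have hPM : 0 < P * M ^ 2 := by positivity
    have h2 : (2 * (n : ℝ) + 2) * D * P * 4 ≤ (2 * (n : ℝ) + 2) * D * P * M ^ 2 := by gcongr
    nlinarith

theorem tendsto_eval_mul_exp_neg_sq (p : Polynomial ℝ) :
    Tendsto (fun x : ℝ => p.eval x * Real.exp (-(x ^ 2 / 2))) atTop (𝓝 0) := by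
  have h : Tendsto (fun x : ℝ => p.eval x * Real.exp (-x)) atTop (𝓝 0) := by
    have := p.tendsto_div_exp_atTop
    refine this.congr fun x => ?_
    rw [Real.exp_neg, div_eq_mul_inv]
  refine squeeze_zero_norm' ?_ (tendsto_norm_zero.comp h)
  filter_upwards [eventually_ge_atTop 2] with x hx
  simp only [Function.comp, norm_mul, Real.norm_eq_abs, Real.abs_exp]
  gcongr
  nlinarith

theorem lintegral_Ioi_odd_moment_le {M : ℝ} (hM : 2 ≤ M) (n : ℕ) :
    ∫⁻ x in Set.Ioi M, ENNReal.ofReal (x ^ (2 * n + 1) * Real.exp (-(x ^ 2 / 2))) ≤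
      ENNReal.ofReal ((2 * n).doubleFactorial * M ^ (2 * n) * Real.exp (-(M ^ 2 / 2))) := by
  have hderiv : ∀ x ∈ Set.Ici M, HasDerivAt
      (fun x : ℝ => -((oddMomentPoly n).eval x * Real.exp (-(x ^ 2 / 2))))
      (x ^ (2 * n + 1) * Real.exp (-(x ^ 2 / 2))) x := by
    intro x _
    have h1 := (oddMomentPoly n).hasDerivAt x
    have h2 : HasDerivAt (fun x : ℝ => Real.exp (-(x ^ 2 / 2)))
        (Real.exp (-(x ^ 2 / 2)) * -x) x := by
      have h3 : HasDerivAt (fun x : ℝ => -(x ^ 2 / 2)) (-x) x := by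
        refine ((hasDerivAt_pow 2 x).div_const 2).fun_neg.congr_deriv ?_
        simp
      exact h3.exp
    refine (h1.fun_mul h2).fun_neg.congr_deriv ?_
    have h4 := congrArg (Polynomial.eval x) (derivative_oddMomentPoly n)
    simp only [Polynomial.eval_sub, Polynomial.eval_mul, Polynomial.eval_X,
      Polynomial.eval_pow] at h4
    rw [← h4]
    ring
  have hlim : Tendsto (fun x : ℝ => -((oddMomentPoly n).eval x * Real.exp (-(x ^ 2 / 2))))
      atTop (𝓝 0) := by
    simpa using (tendsto_eval_mul_exp_neg_sq (oddMomentPoly n)).neg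
  have hpos : ∀ x ∈ Set.Ioi M, 0 ≤ x ^ (2 * n + 1) * Real.exp (-(x ^ 2 / 2)) := by
    intro x hx
    have : 0 < x := by linarith [Set.mem_Ioi.1 hx]
    positivity
  have hint := integrableOn_Ioi_deriv_of_nonneg' hderiv hpos hlim
  rw [← ofReal_integral_eq_lintegral_ofReal hint
    ((ae_restrict_iff' measurableSet_Ioi).2 (ae_of_all _ hpos)),
    integral_Ioi_of_hasDerivAt_of_nonneg' hderiv hpos hlim]
  refine ENNReal.ofReal_le_ofReal ?_
  rw [zero_sub, neg_neg]
  gcongr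
  exact oddMomentPoly_eval_le hM n

/-- Here `1/√(2π) ≤ 1/2`, so that the two tails together carry the constant `1`. -/
theorem gaussianPDFReal_zero_one_le (x : ℝ) :
    gaussianPDFReal 0 1 x ≤ 1 / 2 * Real.exp (-(x ^ 2 / 2)) := by
  rw [gaussianPDFReal]
  simp only [NNReal.coe_one, mul_one, sub_zero, neg_div]
  gcongr
  rw [one_div]
  gcongr
  rw [show (2 : ℝ) = Real.sqrt 4 by
    rw [show (4 : ℝ) = 2 ^ 2 by norm_num, Real.sqrt_sq (by norm_num)]]
  exact Real.sqrt_le_sqrt (by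
    have : Real.sqrt 4 = 2 := by
      rw [show (4 : ℝ) = 2 ^ 2 by norm_num, Real.sqrt_sq (by norm_num)]
    rw [this]
    linarith [Real.pi_gt_three])

theorem lintegral_gaussianReal_Ioi_le {M : ℝ} (hM : 2 ≤ M) (n : ℕ) :
    ∫⁻ x in Set.Ioi M, ENNReal.ofReal (x ^ (2 * n)) ∂(gaussianReal 0 1) ≤
      ENNReal.ofReal (1 / 2 * ((2 * n).doubleFactorial * M ^ (2 * n) *
        Real.exp (-(M ^ 2 / 2)))) := by
  rw [gaussianReal_of_var_ne_zero 0 one_ne_zero, restrict_withDensity measurableSet_Ioi,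
    lintegral_withDensity_eq_lintegral_mul _ (measurable_gaussianPDF 0 1) (by fun_prop),
    ENNReal.ofReal_mul (by norm_num)]
  refine le_trans ?_ (mul_le_mul_right (lintegral_Ioi_odd_moment_le hM n) _)
  rw [← lintegral_const_mul _ (by fun_prop)]
  refine setLIntegral_mono (by fun_prop) fun x hx => ?_
  have hx : M < x := hx
  have hx0 : 0 < x := by linarith
  simp only [Pi.mul_apply, gaussianPDF]
  rw [← ENNReal.ofReal_mul (gaussianPDFReal_nonneg _ _ _), ← ENNReal.ofReal_mul (by norm_num)]
  refine ENNReal.ofReal_le_ofReal ?_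
  -- Raising the exponent to an odd one makes the antiderivative elementary.
  have h1 : x ^ (2 * n) ≤ x ^ (2 * n + 1) := pow_le_pow_right₀ (by linarith) (by omega)
  calc gaussianPDFReal 0 1 x * x ^ (2 * n)
      ≤ (1 / 2 * Real.exp (-(x ^ 2 / 2))) * x ^ (2 * n + 1) := by
        gcongr
        exact gaussianPDFReal_zero_one_le x
    _ = _ := by ring

theorem lintegral_gaussianReal_abs_gt_le {M : ℝ} (hM : 2 ≤ M) (n : ℕ) :
    ∫⁻ x in {x : ℝ | M < |x|}, ENNReal.ofReal (x ^ (2 * n)) ∂(gaussianReal 0 1) ≤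
      ENNReal.ofReal ((2 * n).doubleFactorial * M ^ (2 * n) * Real.exp (-(M ^ 2 / 2))) := by
  have hset : {x : ℝ | M < |x|} = Set.Ioi M ∪ (fun x : ℝ => -x) ⁻¹' Set.Ioi M := by
    ext x
    simp [lt_abs, lt_neg]
  have hneg : ∫⁻ x in (fun x : ℝ => -x) ⁻¹' Set.Ioi M, ENNReal.ofReal (x ^ (2 * n))
      ∂(gaussianReal 0 1) =
      ∫⁻ x in Set.Ioi M, ENNReal.ofReal (x ^ (2 * n)) ∂(gaussianReal 0 1) := by
    have hmap := gaussianReal_map_neg (μ := 0) (v := 1)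
    rw [neg_zero] at hmap
    conv_rhs => rw [← hmap]
    rw [setLIntegral_map measurableSet_Ioi (by fun_prop) measurable_neg]
    simp [pow_mul]
  rw [hset]
  refine (lintegral_union_le _ _ _).trans ?_
  rw [hneg]
  refine (add_le_add (lintegral_gaussianReal_Ioi_le hM n)
    (lintegral_gaussianReal_Ioi_le hM n)).trans ?_
  rw [← ENNReal.ofReal_add (by positivity) (by positivity)]
  exact ENNReal.ofReal_le_ofReal (by linarith)

theorem gaussianReal_zero_one_le_volume (s : Set ℝ) : gaussianReal 0 1 s ≤ volume s := by
  rw [gaussianReal_apply 0 one_ne_zero]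
  calc _ ≤ ∫⁻ _x in s, (1 : ENNReal) := by
        refine lintegral_mono fun x => ?_
        rw [gaussianPDF, ← ENNReal.ofReal_one]
        refine ENNReal.ofReal_le_ofReal ((gaussianPDFReal_zero_one_le x).trans ?_)
        have : Real.exp (-(x ^ 2 / 2)) ≤ 1 := Real.exp_le_one_iff.2 (by
          have := sq_nonneg x
          linarith)
        linarith
    _ = _ := by simp

theorem eLpNorm_indicator_abs_pow_le {M : ℝ} (hM : 2 ≤ M) (n : ℕ) :
    eLpNorm ({x : ℝ | M < |x|}.indicator fun x => |x| ^ n) 2 (gaussianReal 0 1) ≤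
      ENNReal.ofReal (Real.sqrt ((2 * n).doubleFactorial : ℝ) * M ^ n *
        Real.exp (-(M ^ 2 / 4))) := by
  have hms : MeasurableSet {x : ℝ | M < |x|} := measurableSet_lt measurable_const (by fun_prop)
  rw [eLpNorm_indicator_eq_eLpNorm_restrict hms,
    eLpNorm_eq_lintegral_rpow_enorm_toReal (by norm_num) (by norm_num)]
  have h1 : ∀ x : ℝ, ‖|x| ^ n‖ₑ ^ (2 : ENNReal).toReal = ENNReal.ofReal (x ^ (2 * n)) := by
    intro x
    rw [Real.enorm_eq_ofReal (by positivity), ENNReal.toReal_ofNat, ENNReal.rpow_ofNat,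
      ← ENNReal.ofReal_pow (by positivity), ← pow_mul, mul_comm n 2, pow_mul, pow_mul, sq_abs]
  simp only [h1]
  have h2 : (2 * n).doubleFactorial * M ^ (2 * n) * Real.exp (-(M ^ 2 / 2)) =
      (Real.sqrt ((2 * n).doubleFactorial : ℝ) * M ^ n * Real.exp (-(M ^ 2 / 4))) ^ 2 := by
    rw [mul_pow, mul_pow, Real.sq_sqrt (by positivity), ← pow_mul, ← Real.exp_nat_mul]
    congr 2
    · ring
    · push_cast
      ring
  have h3 := lintegral_gaussianReal_abs_gt_le hM n
  rw [h2, ENNReal.ofReal_pow (by positivity)] at h3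
  calc _ ≤ ((ENNReal.ofReal (Real.sqrt ((2 * n).doubleFactorial : ℝ) * M ^ n *
        Real.exp (-(M ^ 2 / 4)))) ^ 2) ^ (1 / (2 : ENNReal).toReal) := by gcongr
    _ = _ := by
      rw [ENNReal.toReal_ofNat, ← ENNReal.rpow_natCast, ← ENNReal.rpow_mul]
      norm_num

/-! ### Cutoff, clipping and the approximating network -/

/-- The trapezoid function that is `1` on `[-(M - η), M - η]` and `0` outside `[-M, M]`. -/
noncomputable def cutoff (M η x : ℝ) : ℝ :=
  (max (x + M) 0 - max (x + M - η) 0 - max (x - M + η) 0 + max (x - M) 0) / η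

/-- The projection onto `[-M, M]`. -/
noncomputable def clip (M x : ℝ) : ℝ := max (x + M) 0 - max (x - M) 0 - M

theorem clip_mem {M : ℝ} (hM : 0 ≤ M) (x : ℝ) : |clip M x| ≤ M := by
  unfold clip
  rw [abs_le]
  rcases max_cases (x + M) 0 with ⟨h, h'⟩ | ⟨h, h'⟩ <;>
    rcases max_cases (x - M) 0 with ⟨k, k'⟩ | ⟨k, k'⟩ <;> rw [h, k] <;> constructor <;> linarith

theorem clip_eq_self {M x : ℝ} (hx : |x| ≤ M) : clip M x = x := by
  obtain ⟨h1, h2⟩ := abs_le.1 hx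
  unfold clip
  rw [max_eq_left (by linarith), max_eq_right (by linarith)]
  ring

theorem cutoff_mem {M η : ℝ} (hη : 0 < η) (hηM : η ≤ M) (x : ℝ) :
    0 ≤ cutoff M η x ∧ cutoff M η x ≤ 1 := by
  unfold cutoff
  rw [le_div_iff₀ hη, div_le_iff₀ hη]
  rcases max_cases (x + M) 0 with ⟨h, h'⟩ | ⟨h, h'⟩ <;>
    rcases max_cases (x - M) 0 with ⟨k, k'⟩ | ⟨k, k'⟩ <;>
    rcases max_cases (x + M - η) 0 with ⟨p, p'⟩ | ⟨p, p'⟩ <;>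
    rcases max_cases (x - M + η) 0 with ⟨q, q'⟩ | ⟨q, q'⟩ <;>
    rw [h, k, p, q] <;> constructor <;> linarith

theorem cutoff_eq_zero {M η x : ℝ} (hη : 0 < η) (hηM : η ≤ M) (hx : M < |x|) :
    cutoff M η x = 0 := by
  unfold cutoff
  rcases lt_abs.1 hx with h | h
  · rw [max_eq_left (by linarith), max_eq_left (by linarith), max_eq_left (by linarith),
      max_eq_left (by linarith)]
    simp
  · rw [max_eq_right (by linarith), max_eq_right (by linarith), max_eq_right (by linarith),
      max_eq_right (by linarith)]
    simp

theorem cutoff_eq_one {M η x : ℝ} (hη : 0 < η) (hx : |x| ≤ M - η) : cutoff M η x = 1 := by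
  obtain ⟨h1, h2⟩ := abs_le.1 hx
  unfold cutoff
  rw [max_eq_left (by linarith), max_eq_left (by linarith), max_eq_right (by linarith),
    max_eq_right (by linarith)]
  field_simp
  ring

theorem reluNet_cutoff_clip (M η : ℝ) :
    ReluNet (fun x : Unit → ℝ => ![cutoff M η (x ()), clip M (x ())]) 3 76 := by
  have h1 : ReluNet (fun x : Unit → ℝ =>
      ![x () + M, x () + M - η, x () - M + η, x () - M]) 1 32 := by
    refine (ReluNet.of_linear
      (f := fun x : Unit → ℝ => ![x () + M, x () + M - η, x () - M + η, x () - M])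
      (fun _ => coordForm ()) ![M, M - η, -M + η, -M] ?_).mono (by simp)
    intro x k
    fin_cases k <;> simp <;> ring
  have h2 : ReluNet (fun x : Fin 4 → ℝ =>
      ![(x 0 - x 1 - x 2 + x 3) / η, x 0 - x 3 - M]) 1 40 := by
    refine (ReluNet.of_linear
      (f := fun x : Fin 4 → ℝ => ![(x 0 - x 1 - x 2 + x 3) / η, x 0 - x 3 - M])
      ![(1 / η) • (coordForm 0 - coordForm 1 - coordForm 2 + coordForm 3),
        coordForm 0 - coordForm 3] ![0, -M] ?_).mono (by simp)
    intro x k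
    fin_cases k <;> simp <;> ring
  exact (((h1.comp ReluNet.relu).comp h2).mono (by simp) : ReluNet _ 3 76)

theorem reluNet_hermiteLeaves (n J : ℕ) (c : ℝ) :
    ReluNet (fun x : Fin 2 → ℝ => treeOfSeq (fun k => c • hermiteFactor n (x 0) (x 1) k) J) 1
      (48 * 2 ^ J) := by
  choose p q r h using hermiteFactor_affine n
  refine (ReluNet.of_linear
    (f := fun x : Fin 2 → ℝ => treeOfSeq (fun k => c • hermiteFactor n (x 0) (x 1) k) J)
    (fun i => c • (treeOfSeq p J i • coordForm 0 + treeOfSeq q J i • coordForm 1))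
    (fun i => c * treeOfSeq r J i) ?_).mono ?_
  · intro x i
    simp only [treeOfSeq, Matrix.smul_apply, smul_eq_mul, h, LinearMap.smul_apply,
      LinearMap.add_apply, coordForm_apply]
    ring
  · rw [card_treeIndex, Fintype.card_fin]
    omega

/-- ReLU networks that approximate the truncated Hermite polynomials uniformly. -/
theorem exists_network_truncated_normHermite {n m J : ℕ} {M η : ℝ} (hM : 1 ≤ M) (hη : 0 < η)
    (hηM : η ≤ M) (hJ : n + 1 ≤ 2 ^ J) (hm : 3 ≤ m) :
    ∃ Φ : FeedforwardNN 1 1,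
      (∀ x, |Φ.reluFun x - cutoff M η x * normHermite n (clip M x)| ≤
        (8 * M) ^ (2 ^ J) * (8 / 4 ^ m)) ∧
      (∀ x, M < |x| → Φ.reluFun x = 0) ∧
      Φ.depth = 5 + J * (3 * m + 6) ∧
      Φ.size ≤ 89 + 48 * 2 ^ J + (2 ^ J - 1) * (1392 * m + 2000) := by
  have h8 : 0 < 8 * M := by linarith
  let L : ℝ → ℕ → Matrix (Fin 2) (Fin 2) ℝ := fun x k =>
    (1 / (8 * M)) • hermiteFactor n (cutoff M η x) (clip M x) k
  have hnet := ((reluNet_cutoff_clip M η).comp (reluNet_hermiteLeaves n J (1 / (8 * M)))).comp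
    (reluNet_treeApprox m J)
  -- The scaling by `1 / (8M)` in each of the `2 ^ J` factors is undone by the output weight, at no
  -- cost in size.
  obtain ⟨Φ, hΦ, hd, hs⟩ := hnet.exists_reluFun (0, 0) ((8 * M) ^ (2 ^ J))
  have hΦ' : ∀ x, Φ.reluFun x =
      (8 * M) ^ (2 ^ J) * treeApprox m J (treeOfSeq (L x) J) (0, 0) := by
    intro x
    rw [hΦ]
    simp [L]
  refine ⟨Φ, fun x => ?_, fun x hx => ?_, by rw [hd]; ring, ?_⟩
  · have hτ := cutoff_mem hη hηM x
    have hL : ∀ k a b, |L x k a b| ≤ 1 / 8 := by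
      intro k a b
      have := abs_hermiteFactor_le (n := n) hM
        (by rw [abs_of_nonneg hτ.1]; exact hτ.2) (clip_mem (by linarith) x) k a b
      simp only [L, Matrix.smul_apply, smul_eq_mul, abs_mul]
      rw [abs_of_pos (by positivity)]
      calc _ ≤ 1 / (8 * M) * M := by gcongr
        _ = 1 / 8 := by field_simp
    have herr := (abs_treeApprox_sub_le hm J (L x) hL 0 0).2
    have hprod : (8 * M) ^ (2 ^ J) * seqProd (L x) (2 ^ J) 0 0 =
        cutoff M η x * normHermite n (clip M x) := by
      simp only [L]
      rw [seqProd_smul, Matrix.smul_apply, smul_eq_mul, seqProd_hermiteFactor _ _ hJ,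
        ← mul_assoc, ← mul_pow, mul_one_div_cancel h8.ne', one_pow, one_mul]
    rw [hΦ', ← hprod, ← mul_sub, abs_mul, abs_of_pos (by positivity)]
    gcongr
  · rw [hΦ', treeApprox_eq_zero, mul_zero]
    simp [L, hermiteFactor, cutoff_eq_zero hη hηM hx]
  · refine hs.trans ?_
    simp only [Fintype.card_prod, Fintype.card_fin]
    omega

/-! ### The error in `L²` -/

theorem measurableSet_annulus (a b : ℝ) : MeasurableSet {x : ℝ | a < |x| ∧ |x| ≤ b} := by
  have h1 : MeasurableSet {x : ℝ | a < |x|} := measurableSet_lt measurable_const (by fun_prop)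
  have h2 : MeasurableSet {x : ℝ | |x| ≤ b} := measurableSet_le (by fun_prop) measurable_const
  exact h1.inter h2

theorem eLpNorm_indicator_annulus_le {M η K : ℝ} (hη : 0 ≤ η) (hK : 0 ≤ K) :
    eLpNorm ({x : ℝ | M - η < |x| ∧ |x| ≤ M}.indicator fun _ => K) 2 (gaussianReal 0 1) ≤
      ENNReal.ofReal (K * Real.sqrt (2 * η)) := by
  rw [eLpNorm_indicator_const (measurableSet_annulus _ _) (by norm_num) (by norm_num), Real.enorm_eq_ofReal hK,
    ENNReal.ofReal_mul hK]
  gcongr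
  have hsub : {x : ℝ | M - η < |x| ∧ |x| ≤ M} ⊆ Set.Ioc (M - η) M ∪ Set.Ico (-M) (η - M) := by
    rintro x ⟨h1, h2⟩
    obtain ⟨h3, h4⟩ := abs_le.1 h2
    rcases lt_abs.1 h1 with h | h
    · exact Or.inl ⟨h, h4⟩
    · exact Or.inr ⟨h3, by linarith⟩
  have hvol : gaussianReal 0 1 {x : ℝ | M - η < |x| ∧ |x| ≤ M} ≤ ENNReal.ofReal (2 * η) := by
    refine (gaussianReal_zero_one_le_volume _).trans ((measure_mono hsub).trans
      ((measure_union_le _ _).trans ?_))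
    rw [Real.volume_Ioc, Real.volume_Ico, ← ENNReal.ofReal_add (by linarith) (by linarith)]
    exact ENNReal.ofReal_le_ofReal (by linarith)
  calc _ ≤ ENNReal.ofReal (2 * η) ^ (1 / (2 : ENNReal).toReal) := by gcongr
    _ = _ := by
      rw [Real.sqrt_eq_rpow, ENNReal.ofReal_rpow_of_nonneg (by linarith) (by norm_num)]
      norm_num

/-- The `L²` error of an approximation of the truncated Hermite polynomial. -/
theorem eLpNorm_normHermite_sub_le {n : ℕ} {M η δ : ℝ} (hM : 2 ≤ M) (hη : 0 < η) (hηM : η ≤ M)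
    (hδ : 0 ≤ δ) {g : ℝ → ℝ}
    (hg : ∀ x, |g x - cutoff M η x * normHermite n (clip M x)| ≤ δ)
    (hg0 : ∀ x, M < |x| → g x = 0) :
    eLpNorm (fun x => normHermite n x - g x) 2 (gaussianReal 0 1) ≤
      ENNReal.ofReal (δ + (3 * M) ^ n * Real.sqrt (2 * η) +
        Real.sqrt ((2 * n).doubleFactorial : ℝ) * (3 * M) ^ n * Real.exp (-(M ^ 2 / 4))) := by
  let f₁ : ℝ → ℝ := fun _ => δ
  let f₂ : ℝ → ℝ := {x : ℝ | M - η < |x| ∧ |x| ≤ M}.indicator fun _ => (3 * M) ^ n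
  let f₃ : ℝ → ℝ := {x : ℝ | M < |x|}.indicator fun x => |x| ^ n
  have hm₂ : Measurable f₂ := measurable_const.indicator (measurableSet_annulus _ _)
  have hm₃ : Measurable f₃ := Measurable.indicator (by fun_prop)
    (measurableSet_lt measurable_const (by fun_prop))
  -- `f₁` is the uniform error, `f₂` pays for the ramps of the cutoff, and `f₃` for the tail, where
  -- `g = 0` and the polynomial bound is used with `R = |x|`.
  have hpt : ∀ x, ‖normHermite n x - g x‖ ≤ (f₁ + f₂ + (3 : ℝ) ^ n • f₃) x := by
    intro x
    simp only [Pi.add_apply, Pi.smul_apply, smul_eq_mul, f₁, f₂, f₃, Set.indicator,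
      Set.mem_ofPred_eq, Real.norm_eq_abs]
    by_cases h1 : M < |x|
    · have h2 := abs_normHermite_le (R := |x|) (by linarith) le_rfl n
      rw [hg0 x h1, if_pos h1, if_neg (by intro h; linarith [h.2]), sub_zero, ← mul_pow]
      linarith
    · have h1' : |x| ≤ M := not_lt.1 h1
      have hx := hg x
      rw [clip_eq_self h1'] at hx
      have hH := abs_normHermite_le (R := M) (by linarith) h1' n
      rw [if_neg h1, mul_zero, add_zero]
      by_cases h2 : M - η < |x|
      · rw [if_pos ⟨h2, h1'⟩]
        have hτ := cutoff_mem hη hηM x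
        have e : normHermite n x - g x = (1 - cutoff M η x) * normHermite n x -
            (g x - cutoff M η x * normHermite n x) := by ring
        rw [e]
        refine (abs_sub _ _).trans ?_
        rw [abs_mul, abs_of_nonneg (by linarith)]
        have : (1 - cutoff M η x) * |normHermite n x| ≤ 1 * (3 * M) ^ n :=
          mul_le_mul (by linarith) hH (abs_nonneg _) zero_le_one
        linarith
      · rw [if_neg (by tauto), add_zero, abs_sub_comm]
        rwa [cutoff_eq_one hη (not_lt.1 h2), one_mul] at hx
  have hK : (0 : ℝ) ≤ (3 * M) ^ n := by positivity
  refine (eLpNorm_mono_real hpt).trans ?_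
  refine (eLpNorm_add_le (aestronglyMeasurable_const.add hm₂.aestronglyMeasurable)
    (hm₃.aestronglyMeasurable.const_smul _) (by norm_num)).trans ?_
  rw [ENNReal.ofReal_add (by positivity) (by positivity)]
  refine add_le_add ?_ ?_
  · refine (eLpNorm_add_le aestronglyMeasurable_const hm₂.aestronglyMeasurable
      (by norm_num)).trans ?_
    rw [ENNReal.ofReal_add (by positivity) (by positivity)]
    refine add_le_add ?_ (eLpNorm_indicator_annulus_le hη.le hK)
    rw [eLpNorm_const _ (by norm_num) (NeZero.ne _), measure_univ, ENNReal.one_rpow, mul_one,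
      Real.enorm_eq_ofReal hδ]
  · rw [eLpNorm_const_smul, Real.enorm_eq_ofReal (by positivity)]
    refine (mul_le_mul_right (eLpNorm_indicator_abs_pow_le hM n) _).trans ?_
    rw [← ENNReal.ofReal_mul (by positivity), mul_pow]
    exact ENNReal.ofReal_le_ofReal (le_of_eq (by ring))

/-! ### Choice of parameters and complexity -/

/-- Half of the least power of two reaching `n + 1` is below `n + 1`. Hence the padding keeps the
number of factors linear in `n`. -/
theorem two_pow_clog_succ_le {n : ℕ} (hn : 1 ≤ n) : 2 ^ Nat.clog 2 (n + 1) ≤ 2 * n := by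
  have h := Nat.pow_pred_clog_lt_self (b := 2) (by norm_num) (x := n + 1) (by omega)
  have hpos : 0 < Nat.clog 2 (n + 1) := Nat.clog_pos (by norm_num) (by omega)
  obtain ⟨j, hj⟩ : ∃ j, Nat.clog 2 (n + 1) = j + 1 := ⟨_, (Nat.succ_pred_eq_of_pos hpos).symm⟩
  rw [hj] at h ⊢
  simp only [Nat.pred_succ] at h
  rw [pow_succ]
  omega

theorem clog_succ_le_log {n : ℕ} (hn : 1 ≤ n) :
    (Nat.clog 2 (n + 1) : ℝ) ≤ 2 * (1 + Real.log n) := by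
  have h : ((2 : ℝ) ^ Nat.clog 2 (n + 1)) ≤ 2 * n := by exact_mod_cast two_pow_clog_succ_le hn
  have hn' : (1 : ℝ) ≤ n := by exact_mod_cast hn
  have h2 := Real.log_le_log (by positivity) h
  rw [Real.log_pow, Real.log_mul (by norm_num) (by positivity)] at h2
  have h3 := Real.log_two_gt_d9
  have h4 := Real.log_two_lt_d9
  have h5 : 0 ≤ Real.log n := Real.log_nonneg hn'
  have h6 : (0 : ℝ) ≤ (Nat.clog 2 (n + 1) : ℝ) := Nat.cast_nonneg _
  nlinarith

/-- The number of sawtooth steps needed for accuracy `ε / 2`. -/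
theorem exists_accuracy {N : ℕ} {A ε : ℝ} (hA : 1 ≤ A) (hε : 0 < ε) (hε1 : ε < 1) :
    ∃ m : ℕ, 3 ≤ m ∧ A ^ N * (8 / 4 ^ m) ≤ ε / 2 ∧
      (m : ℝ) ≤ N * Real.log A - Real.log ε + 7 := by
  have hlogA : 0 ≤ Real.log A := Real.log_nonneg hA
  have hlogε : Real.log ε < 0 := Real.log_neg hε hε1
  have h16 : Real.log 16 ≤ 3 := by
    rw [show (16 : ℝ) = 2 ^ 4 by norm_num, Real.log_pow]
    have := Real.log_two_lt_d9
    push_cast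
    linarith
  have h16' : 0 ≤ Real.log 16 := Real.log_nonneg (by norm_num)
  -- The requirement is `4 ^ m ≥ 16 A ^ N / ε = exp X`, so `m ≥ X` suffices by `e < 4`. The added
  -- `3` ensures `3 ≤ m`, and `7` covers `log 16 ≤ 3`, rounding and this `3`.
  set X := N * Real.log A - Real.log ε + Real.log 16 with hX
  have hX0 : 0 ≤ X := by
    have : 0 ≤ N * Real.log A := by positivity
    linarith
  refine ⟨⌈X⌉₊ + 3, by omega, ?_, ?_⟩
  · have h1 : Real.exp X = A ^ N * 16 / ε := by
      rw [hX, Real.exp_add, Real.exp_sub, Real.exp_log hε, Real.exp_log (by norm_num),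
        Real.exp_nat_mul, Real.exp_log (by linarith)]
      ring
    have h2 : Real.exp X ≤ 4 ^ (⌈X⌉₊ + 3) := by
      calc Real.exp X ≤ Real.exp ((⌈X⌉₊ + 3 : ℕ) * 1) := by
            refine Real.exp_le_exp.2 ?_
            push_cast
            linarith [Nat.le_ceil X]
        _ = Real.exp 1 ^ (⌈X⌉₊ + 3) := Real.exp_nat_mul _ _
        _ ≤ 4 ^ (⌈X⌉₊ + 3) := by
            gcongr
            linarith [Real.exp_one_lt_d9]
    rw [h1, div_le_iff₀ hε] at h2
    rw [mul_div_assoc', div_le_div_iff₀ (by positivity) (by norm_num)]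
    linarith
  · push_cast
    linarith [Nat.ceil_lt_add_one hX0]

theorem proposition3p3 :
    ∃ C : ℝ, 0 < C ∧
      ∀ (n : ℕ) (M ε : ℝ), 2 ≤ M → 0 < ε → ε < Real.exp (-1) →
        ∃ Φ : FeedforwardNN 1 1,
          MeasureTheory.eLpNorm (fun x : ℝ => normHermite n x - Φ.reluFun x) 2
              (ProbabilityTheory.gaussianReal 0 1) ≤
            ENNReal.ofReal
              (ε + Real.sqrt ((2 * n).doubleFactorial : ℝ) * (3 * M) ^ n *
                Real.exp (-(M ^ 2 / 4))) ∧
          (∀ x : ℝ, M < |x| → Φ.reluFun x = 0) ∧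
          (∀ x : ℝ, |Φ.reluFun x| ≤ 1 + (3 * M) ^ n) ∧
          (Φ.size : ℝ) ≤ C * (1 + (n : ℝ) ^ 2 * Real.log M + n * Real.log (n / ε)) ∧
          (Φ.depth : ℝ) ≤ C * ((1 + Real.log n) * (n * Real.log M - Real.log ε)) := by
  refine ⟨50000, by norm_num, fun n M ε hM hε hε1 => ?_⟩
  have hlogε : Real.log ε < -1 := by
    rwa [Real.log_lt_iff_lt_exp hε]
  have hε2 : ε < 1 := hε1.trans (Real.exp_lt_one_iff.2 (by norm_num))
  have hlogM : 0 ≤ Real.log M := Real.log_nonneg (by linarith)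
  have hlog8M : Real.log (8 * M) ≤ 4 * Real.log M := by
    rw [show (4 : ℝ) * Real.log M = Real.log (M ^ 4) by rw [Real.log_pow]; norm_num]
    refine Real.log_le_log (by linarith) ?_
    have : (2 : ℝ) ^ 3 ≤ M ^ 3 := by gcongr
    nlinarith
  set J := Nat.clog 2 (n + 1) with hJ
  obtain ⟨m, hm3, hm, hmle⟩ := exists_accuracy (N := 2 ^ J) (A := 8 * M) (by linarith) hε hε2
  set K : ℝ := (3 * M) ^ n with hKdef
  have hK : 1 ≤ K := one_le_pow₀ (by linarith)
  -- Solves `K * √(2η) = ε / 2`; the other half of `ε` is the uniform network error.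
  set η : ℝ := (ε / (2 * K)) ^ 2 / 2 with hηdef
  have hη : 0 < η := by positivity
  have hηK : K * Real.sqrt (2 * η) = ε / 2 := by
    rw [hηdef, mul_div_cancel₀ _ (two_ne_zero), Real.sqrt_sq (by positivity)]
    field_simp
  have hηM : η ≤ M := by
    have h1 : ε / (2 * K) ≤ 1 := by
      rw [div_le_one (by positivity)]
      linarith
    have h2 : (ε / (2 * K)) ^ 2 ≤ 1 := pow_le_one₀ (by positivity) h1
    linarith
  obtain ⟨Φ, happ, hzero, hdepth, hsize⟩ := exists_network_truncated_normHermite (n := n)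
    (by linarith) hη hηM (Nat.le_pow_clog (by norm_num) (n + 1)) hm3
  have happ' : ∀ x, |Φ.reluFun x - cutoff M η x * normHermite n (clip M x)| ≤ ε / 2 :=
    fun x => (happ x).trans hm
  refine ⟨Φ, ?_, hzero, fun x => ?_, ?_⟩
  · refine (eLpNorm_normHermite_sub_le hM hη hηM (by positivity) happ' hzero).trans
      (le_of_eq ?_)
    rw [hηK, add_halves]
  · have hτ := cutoff_mem hη hηM x
    have hH := abs_normHermite_le (R := M) (by linarith) (clip_mem (by linarith) x) n
    have h1 : |cutoff M η x * normHermite n (clip M x)| ≤ 1 * K := by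
      rw [abs_mul, abs_of_nonneg hτ.1]
      exact mul_le_mul hτ.2 hH (abs_nonneg _) zero_le_one
    have h2 := abs_sub_abs_le_abs_sub (Φ.reluFun x) (cutoff M η x * normHermite n (clip M x))
    linarith [happ' x]
  have hs : (Φ.size : ℝ) ≤ 89 + 48 * 2 ^ J + (2 ^ J - 1) * (1392 * m + 2000) := by
    have : (Φ.size : ℝ) ≤ ((89 + 48 * 2 ^ J + (2 ^ J - 1) * (1392 * m + 2000) : ℕ) : ℝ) := by
      exact_mod_cast hsize
    rw [Nat.cast_add, Nat.cast_mul, Nat.cast_sub Nat.one_le_two_pow] at this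
    push_cast at this
    exact this
  have hd : (Φ.depth : ℝ) = 5 + J * (3 * m + 6) := by
    rw [hdepth]
    push_cast
    ring
  -- For `n = 0` the tree is a single leaf, so size and depth are bounded by constants; `Real.log 0
  -- = 0` and `-log ε > 1` give the depth bound.
  rcases Nat.eq_zero_or_pos n with h0 | hn
  · have hJ0 : J = 0 := by
      rw [hJ, h0]
      simp
    rw [hJ0] at hs hd
    rw [hd, h0]
    norm_num at hs ⊢
    constructor <;> linarith
  · have hn1 : (1 : ℝ) ≤ n := by exact_mod_cast hn
    have h2J : (2 : ℝ) ^ J ≤ 2 * n := by exact_mod_cast two_pow_clog_succ_le hn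
    have hJlog : (J : ℝ) ≤ 2 * (1 + Real.log n) := clog_succ_le_log hn
    have hlogn : 0 ≤ Real.log n := Real.log_nonneg hn1
    set B := n * Real.log M - Real.log ε with hB
    have hnM : 0 ≤ n * Real.log M := by positivity
    have hB1 : 1 ≤ B := by linarith
    -- With `2 ^ J ≤ 2n` and `8M ≤ M ^ 4`, `m ≤ 8 n log M - log ε + 7 ≤ 8B + 7`, and `1 ≤ B`.
    have hmB : (m : ℝ) ≤ 15 * B := by
      have : ((2 ^ J : ℕ) : ℝ) * Real.log (8 * M) ≤ 2 * n * (4 * Real.log M) := by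
        push_cast
        have : 0 ≤ Real.log (8 * M) := Real.log_nonneg (by linarith)
        gcongr
      linarith
    have hm0 : (0 : ℝ) ≤ m := m.cast_nonneg
    constructor
    · have h1 : (2 ^ J - 1) * (1392 * (m : ℝ) + 2000) ≤ 2 * n * (1392 * (15 * B) + 2000) := by
        gcongr
        linarith
      have hnB : (n : ℝ) * B ≤ 1 + (n : ℝ) ^ 2 * Real.log M + n * Real.log (n / ε) := by
        rw [Real.log_div (by positivity) hε.ne', hB]
        have : 0 ≤ n * Real.log n := by positivity
        nlinarith
      have h3 : (n : ℝ) ≤ n * B := le_mul_of_one_le_right (by positivity) hB1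
      calc (Φ.size : ℝ) ≤ 50000 * (n * B) := by linarith
        _ ≤ _ := by gcongr
    · rw [hd]
      have h1 : (J : ℝ) * (3 * m + 6) ≤ 2 * (1 + Real.log n) * (3 * (15 * B) + 6) := by gcongr
      have h2 : 1 + Real.log n ≤ (1 + Real.log n) * B :=
        le_mul_of_one_le_right (by positivity) hB1
      linarith
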